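/- **Model.** Time is slotted. In each slot a random number $M\le M_{\max}$ of new contents is generated, each with a random lifetime $K\in\{1,\dots,K_{\max}\}$ (in slots). The user accesses the network at the epochs of a renewal process with inter-access times $D\in\{1,\dots,D_{\max}\}$. The cost of downloading one content in a slot is a random variable $C$ with values in $[0,C_{\max}]$ and continuous distribution function. All these variables are independent, and those of the same kind (including the costs of different slots) are identically distributed. The state is $(\mathcal O,\mathcal I,E,C)$: the multisets $\mathcal O$ and $\mathcal I$ hold the remaining lifetimes of the relevant contents outside and inside a cache of capacity $B$ ($|\mathcal I|\le B$), $E$ is the number of slots since the last user access ($E=0$ if the user accesses in the current slot), and $C$ is the current channel cost. An action is a pair $(A^{(1)},A^{(2)})$ of multisets: the contents downloaded and the contents leaving the cache; it costs $|A^{(1)}|\cdot C$. If $E=0$, then $A^{(1)}=\mathcal O$ and $A^{(2)}=\mathcal I$ are forced (all relevant contents are consumed), and in the next slot the cache is empty and only the newly generated contents are outside. If $E>0$, any $A^{(1)}\subseteq\mathcal O$, $A^{(2)}\subseteq\mathcal I$ with $|(\mathcal I\cup A^{(1)})\setminus A^{(2)}|\le B$ is allowed; in the next slot the cache holds $(\mathcal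 I\cup A^{(1)})\setminus A^{(2)}$ and the outside holds $(\mathcal O\cup A^{(2)})\setminus A^{(1)}$, with all lifetimes reduced by one and expired contents deleted, and the new contents are added to the outside. A policy is optimal if, from every initial state, it minimizes $\limsup_{T\to\infty}\mathbb E\big[\frac1T\sum_{t=1}^T |A^{(1)}_t|\,C_t\big]$ among all causal (history-dependent, possibly randomized) control strategies. For a state let $l_1\le\dots\le l_B$ be the lifetimes in $\mathcal I$, where each free cache place counts as $0$, and let $L_1\ge\dots\ge L_B$ be the $B$ largest lifetimes in $\mathcal O$, padded with zeros if $|\mathcal O|<B$. The simple action $(l|L)$ downloads $L$ into the cache and removes $l$ from it; $L=0$ means no download and $l=0$ means no removal. **Theorem.** There is an optimal policy that is deterministic and stationary (a function of the current state) and has the following property: for all $\mathcal O,\mathcal I$ and $E>0$ there are $B'\le B$ and thresholds $\mathcal T_{B'}\le\dots\le\mathcal T_1<C_{\max}$ (depending on $\mathcal O,\mathcal I,E$ but not on $C$) such that in the state $(\mathcal O,\mathcal I,E,C)$ the policy performs exactly the simple actions $(l_i|L_i)$ with $1\le i\le B'$ and $C\le\mathcal T_i$. -/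

import Mathlib

open MeasureTheory ProbabilityTheory Filter
open scoped ENNReal

/-- The data of the proactive caching problem. Slots are discrete; in every slot a random number
of new contents with random lifetimes appears, the user accesses the network at the epochs of a
renewal process, and the download cost of a content is the channel cost of the slot. -/
structure CacheModel where
  /-- Cache capacity. -/
  B : ℕ
  Mmax : ℕ
  Kmax : ℕ
  Dmax : ℕ
  Cmax : ℝ
  /-- Law of the number of contents generated in a slot. -/
  lawM : PMF ℕ
  /-- Law of the lifetime of a new content. -/
  lawK : PMF ℕ
  /-- Law of the time between two consecutive user accesses. -/
  lawD : PMF ℕ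
  /-- Law of the channel cost. -/
  lawC : Measure ℝ
  M_le : ∀ n ∈ lawM.support, n ≤ Mmax
  K_pos : ∀ k ∈ lawK.support, 1 ≤ k
  K_le : ∀ k ∈ lawK.support, k ≤ Kmax
  D_pos : ∀ d ∈ lawD.support, 1 ≤ d
  D_le : ∀ d ∈ lawD.support, d ≤ Dmax
  C_prob : IsProbabilityMeasure lawC
  /-- The channel cost is a continuous random variable (its cdf is continuous). -/
  C_cont : NullSingletonClass lawC
  C_mem : ∀ᵐ c ∂lawC, 0 ≤ c ∧ c ≤ Cmax

/-- The discrete part `(O, I, E)` of the state. -/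
@[ext] structure CtrlState where
  /-- Remaining lifetimes of the relevant contents outside the cache. -/
  O : Multiset ℕ
  /-- Remaining lifetimes of the relevant contents in the cache. -/
  I : Multiset ℕ
  /-- Time elapsed since the last user access; it is `0` iff the user accesses in this slot. -/
  E : ℕ

/-- An action: the contents that are downloaded and those that leave the cache. -/
@[ext] structure CacheAction where
  down : Multiset ℕ
  rem : Multiset ℕ

instance : MeasurableSpace CtrlState := ⊤
instance : DiscreteMeasurableSpace CtrlState := ⟨fun _ => trivial⟩
instance : MeasurableSpace CacheAction := ⊤
instance : DiscreteMeasurableSpace CacheAction := ⟨fun _ => trivial⟩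

instance : Countable CtrlState :=
  Function.Injective.countable (f := fun x : CtrlState => (x.O, x.I, x.E)) (by
    rintro ⟨_, _, _⟩ ⟨_, _, _⟩ h; simpa using h)

instance : Countable CacheAction :=
  Function.Injective.countable (f := fun a : CacheAction => (a.down, a.rem)) (by
    rintro ⟨_, _⟩ ⟨_, _⟩ h; simpa using h)

/-- The full state `(O, I, E, C)`. -/
abbrev CacheState := CtrlState × ℝ

/-- The multiset `Z - 1`: lifetimes drop by one and expired contents disappear. -/
def age (Z : Multiset ℕ) : Multiset ℕ := (Z.map (fun z => z - 1)).filter (fun z => z ≠ 0)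

/-- The controlled state in the next slot, given the new contents `N` of that slot and whether
the user accesses (`u = true`) in that slot. -/
def nextCtrl (x : CtrlState) (a : CacheAction) (N : Multiset ℕ) (u : Bool) : CtrlState where
  O := if x.E = 0 then N else age (x.O + a.rem - a.down) + N
  I := if x.E = 0 then 0 else age (x.I + a.down - a.rem)
  E := if u then 0 else x.E + 1

/-- The law of a multiset of `n` independent samples of `K`. -/
noncomputable def iidMultiset (K : PMF ℕ) : ℕ → PMF (Multiset ℕ)
  | 0 => PMF.pure 0
  | n + 1 => (iidMultiset K n).bind fun s => K.map fun k => k ::ₘ s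

namespace CacheModel

/-- The possible controlled states. -/
structure IsState (m : CacheModel) (x : CtrlState) : Prop where
  O_mem : ∀ z ∈ x.O, 1 ≤ z ∧ z ≤ m.Kmax
  I_mem : ∀ z ∈ x.I, 1 ≤ z ∧ z ≤ m.Kmax
  card_le : x.I.card ≤ m.B
  E_lt : ∃ d ∈ m.lawD.support, x.E < d

/-- The action `a` is available in state `x`. When the user accesses, everything outside the cache
is downloaded and the whole cache is emptied into the application layer. -/
def Feasible (m : CacheModel) (x : CtrlState) (a : CacheAction) : Prop :=
  if x.E = 0 then a.down = x.O ∧ a.rem = x.I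
  else a.down ≤ x.O ∧ a.rem ≤ x.I ∧ (x.I + a.down - a.rem).card ≤ m.B

/-- Law of the multiset of the contents generated in one slot. -/
noncomputable def newLaw (m : CacheModel) : PMF (Multiset ℕ) := m.lawM.bind (iidMultiset m.lawK)

open Classical in
/-- Law of the event "the user accesses in the next slot" if the last access was `e` slots ago:
the inter-access time equals `e + 1`, conditionally on being larger than `e`.
(The second branch concerns only elapsed times `e` that cannot occur.) -/
noncomputable def accessLaw (m : CacheModel) (e : ℕ) : PMF Bool :=
  if h : ∃ d ∈ {d : ℕ | e < d}, d ∈ m.lawD.support then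
    (m.lawD.filter {d | e < d} h).map fun d => decide (d = e + 1)
  else PMF.pure true

/-- Transition probabilities of the controlled state. -/
noncomputable def ctrlLaw (m : CacheModel) (x : CtrlState) (a : CacheAction) : PMF CtrlState :=
  m.newLaw.bind fun N => (m.accessLaw x.E).map fun u => nextCtrl x a N u

/-- Transition kernel of the controlled state. -/
noncomputable def ctrlKernel (m : CacheModel) : Kernel (CtrlState × CacheAction) CtrlState where
  toFun p := (m.ctrlLaw p.1 p.2).toMeasure
  measurable' := measurable_of_countable _

/-- Transition kernel of the decision process: the controlled state moves according to
`ctrlKernel`, and the next channel cost is a fresh independent sample. -/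
noncomputable def stateKernel (m : CacheModel) : Kernel (CacheState × CacheAction) CacheState :=
  (m.ctrlKernel.comap (fun p : CacheState × CacheAction => (p.1.1, p.2))
    ((measurable_fst.comp measurable_fst).prodMk measurable_snd)) ×ₖ
  Kernel.const (CacheState × CacheAction) m.lawC

end CacheModel

/-- The cost of an action: number of downloads times channel cost. -/
noncomputable def stageCost (s : CacheState) (a : CacheAction) : ℝ≥0∞ :=
  (a.down.card : ℝ≥0∞) * ENNReal.ofReal s.2

/-- What is known in slot `t` (slots are numbered from `0`): the states and actions of the earlier
slots and the current state. -/
abbrev CacheHist (t : ℕ) := (Fin t → CacheState × CacheAction) × CacheState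

namespace CacheModel

/-- An admissible (causal) control strategy: in every slot an available action is drawn at
random, with a law that may depend on the whole history. -/
structure Policy (m : CacheModel) where
  act : (t : ℕ) → Kernel (CacheHist t) CacheAction
  markov : ∀ t, IsMarkovKernel (act t)
  feasible : ∀ t (h : CacheHist t), ∀ᵐ a ∂(act t h), m.Feasible h.2.1 a

/-- A deterministic stationary policy: a function of the current state. -/
structure StationaryPolicy (m : CacheModel) where
  act : CacheState → CacheAction
  measurable : Measurable act
  feasible : ∀ s, m.Feasible s.1 (act s)

/-- A deterministic stationary policy as an admissible control strategy. -/
noncomputable def StationaryPolicy.toPolicy {m : CacheModel} (p : m.StationaryPolicy) :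
    m.Policy where
  act _ := Kernel.deterministic (fun h => p.act h.2) (p.measurable.comp measurable_snd)
  markov _ := inferInstance
  feasible t h := by
    rw [Kernel.deterministic_apply, ae_dirac_eq]
    exact p.feasible h.2

/-- The law of the history up to slot `t` under a policy, from a given initial state. -/
noncomputable def histLaw (m : CacheModel) (p : m.Policy) (s₀ : CacheState) :
    (t : ℕ) → Measure (CacheHist t)
  | 0 => Measure.dirac (Fin.elim0, s₀)
  | t + 1 =>
    ((histLaw m p s₀ t ⊗ₘ p.act t) ⊗ₘ
      (m.stateKernel.comap (fun q : CacheHist t × CacheAction => (q.1.2, q.2))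
        ((measurable_snd.comp measurable_fst).prodMk measurable_snd))).map
      fun q => (Fin.snoc (α := fun _ => CacheState × CacheAction) q.1.1.1 (q.1.1.2, q.1.2), q.2)

/-- The expected average cost over the first `T` slots. -/
noncomputable def expAvgCost (m : CacheModel) (p : m.Policy) (s₀ : CacheState) (T : ℕ) : ℝ≥0∞ :=
  ∫⁻ h, (∑ i, stageCost (h.1 i).1 (h.1 i).2) / T ∂(m.histLaw p s₀ T)

/-- The long-term average cost. -/
noncomputable def avgCost (m : CacheModel) (p : m.Policy) (s₀ : CacheState) : ℝ≥0∞ :=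
  limsup (fun T => m.expAvgCost p s₀ T) atTop

/-- The policy minimizes the long-term average cost among all admissible control strategies,
from every initial state. -/
def IsOptimal (m : CacheModel) (p : m.Policy) : Prop :=
  ∀ x : CtrlState, m.IsState x → ∀ c : ℝ, ∀ q : m.Policy, m.avgCost p (x, c) ≤ m.avgCost q (x, c)

/-- The cache contents `l_1 ≤ ⋯ ≤ l_B` (indexed from `0`). A free cache place counts as `0`, so
that the zeros come first. -/
def shortest (m : CacheModel) (x : CtrlState) (i : ℕ) : ℕ :=
  (List.replicate (m.B - x.I.card) 0 ++ x.I.sort (· ≤ ·)).getD i 0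

/-- The largest lifetimes `L_1 ≥ L_2 ≥ ⋯` outside the cache (indexed from `0`), followed by
zeros. -/
def longest (x : CtrlState) (i : ℕ) : ℕ := (x.O.sort (· ≥ ·)).getD i 0

/-- The action that consists of the simple actions `(l_i|L_i)`, `i ∈ J`: each `L_i` is downloaded
and each `l_i` is removed, where `L_i = 0` means no download and `l_i = 0` means no removal. -/
def swaps (m : CacheModel) (x : CtrlState) (J : Finset ℕ) : CacheAction where
  down := (J.val.map (longest x)).filter (fun z => z ≠ 0)
  rem := (J.val.map (m.shortest x)).filter (fun z => z ≠ 0)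

end CacheModel

/-! An access consumes all contents, so the slot after it has a law that depends neither on the past
nor on the action. The elapsed time `E` evolves independently of the actions, so all policies have
the same access probabilities. Hence it suffices to minimize the cost up to the next access, a
problem with horizon at most `Dmax`, whose value is `value`.

Within a cycle the contents present do not depend on the actions; only their location does. A cache
is measured by its tails, the numbers of lifetimes at least `k` for every `k ≥ 1`. If the tails of
one cache exceed those of another by at most `n`, with the same contents overall, the advantage is
worth at most `n` downloads at the mean cost (`cycleCost_le_of_tail_le`): the poorer state can
imitate the richer one without paying more before the access, and then downloads at most `n`
additional contents. The imitation works because, for a given number of downloads, the first simple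
actions maximize all tails simultaneously (`min_le_tail_cache_swaps`).

Therefore only the number `j` of simple actions has to be chosen, minimizing `j * c + Q j`. Its
largest minimizer is antitone in `c` with closed superlevel sets, which gives thresholds
(`exists_antitone_minimizer`). They lie below `Cmax` because `Q 0 ≤ Q j + j * meanCost` and
`meanCost < Cmax`.

For optimality, `costToAccess`, the expected past cost plus the value of the current state, grows
per slot by at least `renewalCost` times the access probability under any policy, and by at most
that under the threshold policy. The residual value is bounded in mean, so it vanishes after
division by `T`. -/

/-! ### Tail counts and sorted lists of lifetimes -/

/-- The number of elements of `Z` that are at least `k`. -/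
def tail (k : ℕ) (Z : Multiset ℕ) : ℕ := Z.countP (k ≤ ·)

theorem tail_add (k : ℕ) (Y Z : Multiset ℕ) : tail k (Y + Z) = tail k Y + tail k Z :=
  Multiset.countP_add _ _ _

theorem tail_le_card (k : ℕ) (Z : Multiset ℕ) : tail k Z ≤ Z.card := Multiset.countP_le_card _ _

theorem tail_mono (k : ℕ) {Y Z : Multiset ℕ} (h : Y ≤ Z) : tail k Y ≤ tail k Z :=
  Multiset.countP_le_of_le _ h

theorem tail_sub (k : ℕ) {Y Z : Multiset ℕ} (h : Y ≤ Z) : tail k (Z - Y) = tail k Z - tail k Y :=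
  Multiset.countP_sub h _

theorem tail_one {Z : Multiset ℕ} (h : 0 ∉ Z) : tail 1 Z = Z.card := by
  refine Multiset.countP_eq_card.2 fun z hz => ?_
  rcases Nat.eq_zero_or_pos z with rfl | hp
  · exact absurd hz h
  · exact hp

/-- Aging only shifts the level, so a comparison of tails at all levels `k ≥ 1` survives a slot.
Level `0` is excluded because expired contents are deleted. -/
theorem tail_age {k : ℕ} (hk : 1 ≤ k) (Z : Multiset ℕ) : tail k (age Z) = tail (k + 1) Z := by
  unfold tail age
  rw [Multiset.countP_filter, Multiset.countP_map, Multiset.countP_eq_card_filter]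
  congr 1
  refine Multiset.filter_congr fun z _ => ?_
  omega

theorem age_add (Y Z : Multiset ℕ) : age (Y + Z) = age Y + age Z := by
  simp [age]

theorem zero_notMem_age (Z : Multiset ℕ) : 0 ∉ age Z := by
  simp [age]

theorem card_age_le (Z : Multiset ℕ) : (age Z).card ≤ Z.card := by
  unfold age
  exact (Multiset.card_le_card (Multiset.filter_le _ _)).trans (Multiset.card_map _ _).le

theorem exists_mem_of_mem_age {Z : Multiset ℕ} {z : ℕ} (h : z ∈ age Z) : 1 ≤ z ∧ z + 1 ∈ Z := by
  simp only [age, Multiset.mem_filter, Multiset.mem_map] at h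
  obtain ⟨⟨y, hy, rfl⟩, h0⟩ := h
  refine ⟨by omega, ?_⟩
  rwa [Nat.sub_add_cancel (by omega)]

/-- The default `0` is below every level `k ≥ 1`, so indices past the end need no bound; in the
increasing case below they do. -/
theorem le_getD_iff_of_antitone {l : List ℕ} (hl : l.Pairwise (· ≥ ·)) {k : ℕ} (hk : 1 ≤ k) (i : ℕ) :
    k ≤ l.getD i 0 ↔ i < l.countP (fun z => decide (k ≤ z)) := by
  induction l generalizing i with
  | nil => simp; omega
  | cons x l ih =>
    rw [List.pairwise_cons] at hl
    by_cases hx : k ≤ x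
    · cases i with
      | zero => simp [hx]
      | succ i => simpa [hx] using ih hl.2 i
    · have h0 : l.countP (fun z => decide (k ≤ z)) = 0 := by
        rw [List.countP_eq_zero]
        intro z hz
        have := hl.1 z hz
        simp only [decide_eq_true_eq]; omega
      cases i with
      | zero => simp [hx, h0]
      | succ i => simpa [hx, h0] using ih hl.2 i

theorem le_getD_iff_of_monotone {l : List ℕ} (hl : l.Pairwise (· ≤ ·)) (k : ℕ) {i : ℕ}
    (hi : i < l.length) :
    k ≤ l.getD i 0 ↔ l.length - l.countP (fun z => decide (k ≤ z)) ≤ i := by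
  induction l generalizing i with
  | nil => simp at hi
  | cons x l ih =>
    rw [List.pairwise_cons] at hl
    have hc := List.countP_le_length (p := fun z => decide (k ≤ z)) (l := l)
    by_cases hx : k ≤ x
    · have h0 : l.countP (fun z => decide (k ≤ z)) = l.length := by
        rw [List.countP_eq_length]
        intro z hz
        have := hl.1 z hz
        simp only [decide_eq_true_eq]; omega
      cases i with
      | zero => simp [hx, h0]
      | succ i =>
        have := ih hl.2 (i := i) (by simpa using hi)
        simp [hx, h0] at this ⊢
        exact this
    · cases i with
      | zero => simp [hx]; omega
      | succ i =>
        have := ih hl.2 (i := i) (by simpa using hi)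
        simp [hx] at this ⊢
        rw [this]; omega

theorem filter_map_getD_range_le (l : List ℕ) (j : ℕ) :
    ((Finset.range j).val.map (fun i => l.getD i 0)).filter (fun z => z ≠ 0) ≤ (l : Multiset ℕ) := by
  have key : ∀ (l : List ℕ) (j : ℕ),
      (((List.range j).map (fun i => l.getD i 0)).filter (fun z => decide (z ≠ 0))).Sublist l := by
    intro l
    induction l with
    | nil => intro j; simp
    | cons x l ih =>
      intro j
      cases j with
      | zero => simp
      | succ j =>
        have := ih j
        rw [List.range_succ_eq_map]
        simp only [List.map_cons, List.map_map, List.filter_cons]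
        have e : (fun i => (x :: l).getD i 0) ∘ Nat.succ = fun i => l.getD i 0 := by
          ext i; simp
        rw [e]
        split_ifs
        · simpa using this
        · exact this.trans (List.sublist_cons_self _ _)
  exact Multiset.coe_le.2 (key l j).subperm

theorem tail_filter_map_range (g : ℕ → ℕ) (j : ℕ) {k : ℕ} (hk : 1 ≤ k) :
    tail k (((Finset.range j).val.map g).filter (fun z => z ≠ 0)) =
      ((Finset.range j).filter (fun i => k ≤ g i)).card := by
  unfold tail
  rw [Multiset.countP_filter, Multiset.countP_map, Finset.card_def, Finset.filter_val]
  congr 1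
  refine Multiset.filter_congr fun z _ => ?_
  omega

/-! ### Simple actions and the cache contents they produce -/

namespace CacheModel

/-- Together with `le_shortest_iff`, this turns comparisons of sorted lifetimes into linear
arithmetic on tail counts. -/
theorem le_longest_iff (x : CtrlState) {k : ℕ} (hk : 1 ≤ k) (i : ℕ) :
    k ≤ longest x i ↔ i < tail k x.O := by
  unfold longest tail
  rw [le_getD_iff_of_antitone (Multiset.pairwise_sort _ _) hk, ← Multiset.coe_countP,
    Multiset.sort_eq]

theorem pairwise_shortest (m : CacheModel) (x : CtrlState) :
    (List.replicate (m.B - x.I.card) 0 ++ x.I.sort (· ≤ ·)).Pairwise (· ≤ ·) := by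
  rw [List.pairwise_append]
  refine ⟨by simp [List.pairwise_replicate], Multiset.pairwise_sort _ _, ?_⟩
  intro a ha b _
  rw [(List.mem_replicate.1 ha).2]
  exact Nat.zero_le _

theorem le_shortest_iff (m : CacheModel) {x : CtrlState} (hx : x.I.card ≤ m.B) {k : ℕ} (hk : 1 ≤ k)
    {i : ℕ} (hi : i < m.B) : k ≤ m.shortest x i ↔ m.B - tail k x.I ≤ i := by
  have hl : (List.replicate (m.B - x.I.card) 0 ++ x.I.sort (· ≤ ·)).length = m.B := by
    simp; omega
  unfold shortest
  rw [le_getD_iff_of_monotone (m.pairwise_shortest x) k (by rw [hl]; exact hi), hl,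
    List.countP_append, List.countP_replicate]
  have : (x.I.sort (· ≤ ·)).countP (fun z => decide (k ≤ z)) = tail k x.I := by
    unfold tail
    rw [← Multiset.coe_countP, Multiset.sort_eq]
  have h0 : k ≠ 0 := by omega
  simp [this, h0]

theorem swaps_down_le (m : CacheModel) (x : CtrlState) (j : ℕ) :
    (m.swaps x (Finset.range j)).down ≤ x.O := by
  have := filter_map_getD_range_le (x.O.sort (· ≥ ·)) j
  rwa [Multiset.sort_eq] at this

theorem swaps_rem_le (m : CacheModel) (x : CtrlState) (j : ℕ) :
    (m.swaps x (Finset.range j)).rem ≤ x.I := by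
  have h := filter_map_getD_range_le (List.replicate (m.B - x.I.card) 0 ++ x.I.sort (· ≤ ·)) j
  -- Filtering once more leaves the left side unchanged and deletes the padding zeros on the right.
  have h2 := Multiset.filter_le_filter (fun z => z ≠ 0) h
  rw [Multiset.filter_filter] at h2
  simp only [and_self] at h2
  refine h2.trans ?_
  rw [← Multiset.coe_add, Multiset.filter_add, Multiset.sort_eq, Multiset.coe_replicate]
  have : Multiset.filter (fun z => z ≠ 0) (Multiset.replicate (m.B - x.I.card) 0) = 0 := by
    rw [Multiset.filter_eq_nil]
    intro a ha
    simpa using Multiset.eq_of_mem_replicate ha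
  rw [this, zero_add]
  exact Multiset.filter_le _ _

theorem tail_swaps_down (m : CacheModel) (x : CtrlState) (j : ℕ) {k : ℕ} (hk : 1 ≤ k) :
    tail k (m.swaps x (Finset.range j)).down = min j (tail k x.O) := by
  unfold swaps
  rw [tail_filter_map_range _ _ hk]
  simp only [le_longest_iff x hk]
  have : (Finset.range j).filter (fun i => i < tail k x.O) = Finset.range (min j (tail k x.O)) := by
    ext i; simp
  rw [this, Finset.card_range]

theorem tail_swaps_rem (m : CacheModel) {x : CtrlState} (hx : x.I.card ≤ m.B) {j : ℕ} (hj : j ≤ m.B)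
    {k : ℕ} (hk : 1 ≤ k) :
    tail k (m.swaps x (Finset.range j)).rem = j - (m.B - tail k x.I) := by
  unfold swaps
  rw [tail_filter_map_range _ _ hk]
  have : (Finset.range j).filter (fun i => k ≤ m.shortest x i) = Finset.Ico (m.B - tail k x.I) j := by
    ext i
    simp only [Finset.mem_filter, Finset.mem_range, Finset.mem_Ico]
    constructor
    · rintro ⟨h1, h2⟩
      exact ⟨(m.le_shortest_iff hx hk (by omega)).1 h2, h1⟩
    · rintro ⟨h1, h2⟩
      exact ⟨h2, (m.le_shortest_iff hx hk (by omega)).2 h1⟩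
  rw [this, Nat.card_Ico]

theorem zero_notMem_swaps (m : CacheModel) (x : CtrlState) (J : Finset ℕ) :
    0 ∉ (m.swaps x J).down ∧ 0 ∉ (m.swaps x J).rem := by
  simp [swaps]

/-- The simple actions `(l_i|L_i)` that put a longer lifetime into the cache are those with
`i < gain`. -/
theorem exists_gain (m : CacheModel) (x : CtrlState) :
    ∃ g ≤ m.B, (∀ i < g, m.shortest x i < longest x i) ∧
      (g < m.B → longest x g ≤ m.shortest x g) := by
  by_cases h : ∃ i, i < m.B ∧ longest x i ≤ m.shortest x i
  · classical
    refine ⟨Nat.find h, (Nat.find_spec h).1.le, fun i hi => ?_, fun _ => (Nat.find_spec h).2⟩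
    have := Nat.find_min h hi
    have := (Nat.find_spec h).1
    push Not at *
    exact ‹i < m.B → _› (by omega)
  · push Not at h
    exact ⟨m.B, le_rfl, h, fun h => absurd h (lt_irrefl _)⟩

/-- A number of simple actions that put a longer lifetime into the cache. -/
noncomputable def gain (m : CacheModel) (x : CtrlState) : ℕ := (m.exists_gain x).choose

theorem gain_le (m : CacheModel) (x : CtrlState) : m.gain x ≤ m.B := (m.exists_gain x).choose_spec.1

theorem shortest_lt_longest (m : CacheModel) (x : CtrlState) :
    ∀ i < m.gain x, m.shortest x i < longest x i := (m.exists_gain x).choose_spec.2.1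

theorem longest_gain_le (m : CacheModel) (x : CtrlState) :
    m.gain x < m.B → longest x (m.gain x) ≤ m.shortest x (m.gain x) :=
  (m.exists_gain x).choose_spec.2.2

/-- Below `gain` every `L_i` exceeds `l_i ≥ 0`, so no download is a padding zero and `j` simple
actions cost exactly `j` downloads. -/
theorem card_swaps_down (m : CacheModel) (x : CtrlState) {j : ℕ} (hj : j ≤ m.gain x) :
    (m.swaps x (Finset.range j)).down.card = j := by
  rw [← tail_one (m.zero_notMem_swaps x _).1, tail_swaps_down _ _ _ le_rfl]
  rcases Nat.eq_zero_or_pos j with rfl | hj0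
  · simp
  · have := m.shortest_lt_longest x (j - 1) (by omega)
    have := (le_longest_iff x le_rfl (j - 1)).1 (by omega)
    omega

theorem tail_cache_swaps (m : CacheModel) {x : CtrlState} (hx : x.I.card ≤ m.B) {j : ℕ}
    (hj : j ≤ m.B) {k : ℕ} (hk : 1 ≤ k) :
    tail k (x.I + (m.swaps x (Finset.range j)).down - (m.swaps x (Finset.range j)).rem) =
      tail k x.I + min j (tail k x.O) - (j - (m.B - tail k x.I)) := by
  rw [tail_sub, tail_add, tail_swaps_down _ _ _ hk, tail_swaps_rem _ hx hj hk]
  exact (m.swaps_rem_le x j).trans (Multiset.le_add_right _ _)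

theorem feasible_swaps (m : CacheModel) {x : CtrlState} (hE : x.E ≠ 0) (hx : x.I.card ≤ m.B)
    (h0 : 0 ∉ x.I) {j : ℕ} (hj : j ≤ m.B) : m.Feasible x (m.swaps x (Finset.range j)) := by
  rw [Feasible, if_neg hE]
  refine ⟨m.swaps_down_le x j, m.swaps_rem_le x j, ?_⟩
  rw [← tail_one, m.tail_cache_swaps hx hj le_rfl, tail_one h0]
  · omega
  · intro h
    have := Multiset.mem_of_le (Multiset.sub_le_self _ _) h
    rw [Multiset.mem_add] at this
    exact this.elim h0 (m.zero_notMem_swaps x _).1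

/-- Among the actions with at most `n` downloads, the first `n` simple actions that put a longer
lifetime into the cache lead to the best cache contents. -/
theorem min_le_tail_cache_swaps (m : CacheModel) {x : CtrlState} (hx : x.I.card ≤ m.B) (n : ℕ)
    {k : ℕ} (hk : 1 ≤ k) :
    min m.B (min (tail k x.I + n) (tail k x.O + tail k x.I)) ≤
      tail k (x.I + (m.swaps x (Finset.range (min n (m.gain x)))).down -
        (m.swaps x (Finset.range (min n (m.gain x)))).rem) := by
  have hg := m.gain_le x
  have hc := tail_le_card k x.I
  rw [m.tail_cache_swaps hx (by omega) hk]
  set a := tail k x.O with ha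
  set b := tail k x.I with hb
  by_cases h1 : a < min n (m.gain x)
  · -- the last executed simple action removes a lifetime below `k`
    have hlt := m.shortest_lt_longest x (min n (m.gain x) - 1) (by omega)
    have h2 := (le_longest_iff x hk (min n (m.gain x) - 1)).not
    have h3 := (m.le_shortest_iff hx hk (i := min n (m.gain x) - 1) (by omega)).not
    rw [← ha] at h2
    rw [← hb] at h3
    have h4 := h2.2 (by omega)
    have h5 := h3.1 (by omega)
    omega
  -- All executed downloads now have lifetime at least `k`, so the new tail is `min (b + j) B` with
  -- `j = min n gain`. If `gain < n` and `gain < B`, the crossing at index `gain` decides: either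
  -- `l` has reached level `k` there and the tail is `B`, or `L` has dropped below `k` and
  -- everything at level `k` is in the cache.
  · by_cases h2 : n ≤ m.gain x
    · omega
    · by_cases h3 : m.gain x = m.B
      · omega
      · have h4 := m.longest_gain_le x (by omega)
        have h5 := le_longest_iff x hk (m.gain x)
        have h6 := m.le_shortest_iff hx hk (i := m.gain x) (by omega)
        rw [← ha] at h5
        rw [← hb] at h6
        by_cases h7 : k ≤ m.shortest x (m.gain x)
        · have := h6.1 h7
          omega
        · have h8 := h5.not.1 (by omega)
          have h9 := h6.not.1 h7
          omega

end CacheModel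

/-! ### Expectations over discrete laws -/

namespace PMF

variable {α β : Type*}

/-- The expectation of a nonnegative function. -/
noncomputable def expect (p : PMF α) (f : α → ℝ≥0∞) : ℝ≥0∞ := ∑' a, p a * f a

theorem expect_pure (a : α) (f : α → ℝ≥0∞) : (PMF.pure a).expect f = f a := by
  unfold expect
  rw [tsum_eq_single a]
  · simp
  · intro b hb
    simp [hb]

theorem expect_bind (p : PMF α) (q : α → PMF β) (f : β → ℝ≥0∞) :
    (p.bind q).expect f = p.expect fun a => (q a).expect f := by
  unfold expect
  simp_rw [bind_apply, ← ENNReal.tsum_mul_right, ← ENNReal.tsum_mul_left]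
  rw [ENNReal.tsum_comm]
  simp_rw [mul_assoc]

theorem expect_map (p : PMF α) (g : α → β) (f : β → ℝ≥0∞) :
    (p.map g).expect f = p.expect fun a => f (g a) := by
  rw [← bind_pure_comp, expect_bind]
  simp [expect_pure]

theorem expect_mono (p : PMF α) {f g : α → ℝ≥0∞} (h : ∀ a ∈ p.support, f a ≤ g a) :
    p.expect f ≤ p.expect g := by
  refine ENNReal.tsum_le_tsum fun a => ?_
  by_cases ha : p a = 0
  · simp [ha]
  · exact mul_le_mul_right (h a ((mem_support_iff _ _).2 ha)) _

theorem expect_congr (p : PMF α) {f g : α → ℝ≥0∞} (h : ∀ a ∈ p.support, f a = g a) :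
    p.expect f = p.expect g :=
  le_antisymm (p.expect_mono fun a ha => (h a ha).le) (p.expect_mono fun a ha => (h a ha).ge)

theorem expect_const (p : PMF α) (c : ℝ≥0∞) : (p.expect fun _ => c) = c := by
  unfold expect
  rw [ENNReal.tsum_mul_right, p.tsum_coe, one_mul]

theorem expect_add (p : PMF α) (f g : α → ℝ≥0∞) :
    (p.expect fun a => f a + g a) = p.expect f + p.expect g := by
  unfold expect
  simp_rw [mul_add]
  exact ENNReal.tsum_add

theorem lintegral_toMeasure [MeasurableSpace α] [DiscreteMeasurableSpace α] [Countable α]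
    (p : PMF α) (f : α → ℝ≥0∞) : ∫⁻ a, f a ∂p.toMeasure = p.expect f := by
  rw [lintegral_countable']
  refine tsum_congr fun a => ?_
  rw [toMeasure_apply_singleton _ _ (measurableSet_singleton a), mul_comm]

end PMF

theorem mem_support_iidMultiset (K : PMF ℕ) {n : ℕ} {N : Multiset ℕ}
    (h : N ∈ (iidMultiset K n).support) : N.card = n ∧ ∀ z ∈ N, z ∈ K.support := by
  induction n generalizing N with
  | zero =>
    simp only [iidMultiset, PMF.support_pure, Set.mem_singleton_iff] at h
    simp [h]
  | succ n ih =>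
    simp only [iidMultiset, PMF.mem_support_bind_iff, PMF.mem_support_map_iff] at h
    obtain ⟨s, hs, k, hk, rfl⟩ := h
    obtain ⟨h1, h2⟩ := ih hs
    refine ⟨by simp [h1], fun z hz => ?_⟩
    rcases Multiset.mem_cons.1 hz with rfl | hz
    · exact hk
    · exact h2 z hz

/-! ### Transitions, cycle costs and comparison of caches -/

namespace CacheModel

theorem mem_support_newLaw (m : CacheModel) {N : Multiset ℕ} (h : N ∈ m.newLaw.support) :
    N.card ≤ m.Mmax ∧ ∀ z ∈ N, 1 ≤ z ∧ z ≤ m.Kmax := by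
  simp only [newLaw, PMF.mem_support_bind_iff] at h
  obtain ⟨n, hn, hN⟩ := h
  obtain ⟨h1, h2⟩ := mem_support_iidMultiset _ hN
  exact ⟨h1.le.trans (m.M_le n hn), fun z hz => ⟨m.K_pos z (h2 z hz), m.K_le z (h2 z hz)⟩⟩

theorem false_mem_support_accessLaw (m : CacheModel) {e : ℕ}
    (h : false ∈ (m.accessLaw e).support) : ∃ d ∈ m.lawD.support, e + 1 < d := by
  unfold accessLaw at h
  split_ifs at h with hd
  · rw [PMF.mem_support_map_iff] at h
    obtain ⟨d, hd1, hd2⟩ := h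
    rw [PMF.mem_support_filter_iff] at hd1
    refine ⟨d, hd1.2, ?_⟩
    have h3 : e < d := hd1.1
    have h4 : d ≠ e + 1 := by simpa using hd2
    omega
  · simp at h

theorem isState_nextCtrl (m : CacheModel) {x : CtrlState} (hx : m.IsState x) {a : CacheAction}
    (ha : m.Feasible x a) {N : Multiset ℕ} (hN : N ∈ m.newLaw.support) {u : Bool}
    (hu : u ∈ (m.accessLaw x.E).support) : m.IsState (nextCtrl x a N u) := by
  have hN' := (m.mem_support_newLaw hN).2
  have hE : ∃ d ∈ m.lawD.support, (nextCtrl x a N u).E < d := by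
    cases u with
    | false => exact m.false_mem_support_accessLaw hu
    | true =>
      obtain ⟨d, hd⟩ := m.lawD.support_nonempty
      exact ⟨d, hd, m.D_pos d hd⟩
  by_cases h0 : x.E = 0
  · refine ⟨?_, ?_, ?_, hE⟩ <;> simp only [nextCtrl, if_pos h0]
    · exact hN'
    · simp
    · simp
  · rw [Feasible, if_neg h0] at ha
    obtain ⟨h1, h2, h3⟩ := ha
    refine ⟨?_, ?_, ?_, hE⟩ <;> simp only [nextCtrl, if_neg h0]
    · intro z hz
      rcases Multiset.mem_add.1 hz with hz | hz
      · obtain ⟨h4, h5⟩ := exists_mem_of_mem_age hz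
        refine ⟨h4, ?_⟩
        rcases Multiset.mem_add.1 (Multiset.mem_of_le (Multiset.sub_le_self _ _) h5) with h6 | h6
        · have := (hx.O_mem _ h6).2; omega
        · have := (hx.I_mem _ (Multiset.mem_of_le h2 h6)).2; omega
      · exact hN' z hz
    · intro z hz
      obtain ⟨h4, h5⟩ := exists_mem_of_mem_age hz
      refine ⟨h4, ?_⟩
      rcases Multiset.mem_add.1 (Multiset.mem_of_le (Multiset.sub_le_self _ _) h5) with h6 | h6
      · have := (hx.I_mem _ h6).2; omega
      · have := (hx.O_mem _ (Multiset.mem_of_le h1 h6)).2; omega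
    · exact (card_age_le _).trans h3

/-- The expectation of a function of the next controlled state. -/
noncomputable def nextExp (m : CacheModel) (f : CtrlState → ℝ≥0∞) (x : CtrlState)
    (a : CacheAction) : ℝ≥0∞ :=
  m.newLaw.expect fun N => (m.accessLaw x.E).expect fun u => f (nextCtrl x a N u)

theorem lintegral_ctrlLaw (m : CacheModel) (f : CtrlState → ℝ≥0∞) (x : CtrlState)
    (a : CacheAction) : ∫⁻ y, f y ∂(m.ctrlLaw x a).toMeasure = m.nextExp f x a := by
  rw [PMF.lintegral_toMeasure, ctrlLaw, PMF.expect_bind]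
  simp_rw [PMF.expect_map]
  rfl

theorem nextExp_mono (m : CacheModel) {f g : CtrlState → ℝ≥0∞} {x : CtrlState} {a : CacheAction}
    (h : ∀ N ∈ m.newLaw.support, ∀ u ∈ (m.accessLaw x.E).support,
      f (nextCtrl x a N u) ≤ g (nextCtrl x a N u)) : m.nextExp f x a ≤ m.nextExp g x a :=
  PMF.expect_mono _ fun N hN => PMF.expect_mono _ fun u hu => h N hN u hu

theorem nextExp_congr (m : CacheModel) {f g : CtrlState → ℝ≥0∞} {x : CtrlState} {a : CacheAction}
    (h : ∀ N ∈ m.newLaw.support, ∀ u ∈ (m.accessLaw x.E).support,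
      f (nextCtrl x a N u) = g (nextCtrl x a N u)) : m.nextExp f x a = m.nextExp g x a :=
  PMF.expect_congr _ fun N hN => PMF.expect_congr _ fun u hu => h N hN u hu

/-- The mean channel cost. -/
noncomputable def meanCost (m : CacheModel) : ℝ≥0∞ := ∫⁻ c, ENNReal.ofReal c ∂m.lawC

/-- The least expected cost until the next user access, before the channel cost of the current slot
is revealed; after `f` slots no more downloads are made before the access. -/
noncomputable def cycleCost (m : CacheModel) : ℕ → CtrlState → ℝ≥0∞
  | 0, x => x.O.card * m.meanCost
  | f + 1, x =>
    if x.E = 0 then x.O.card * m.meanCost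
    else ∫⁻ c, ⨅ (a : CacheAction) (_ : m.Feasible x a),
      (stageCost (x, c) a + m.nextExp (cycleCost m f) x a) ∂m.lawC

theorem cycleCost_of_access (m : CacheModel) (f : ℕ) {x : CtrlState} (h : x.E = 0) :
    m.cycleCost f x = x.O.card * m.meanCost := by
  cases f with
  | zero => rfl
  | succ f => simp [cycleCost, h]

/-- For every action in one state, some first simple actions in another state with the same
contents cost at most as much and preserve a bound on the difference of the cache contents. -/
theorem exists_swaps (m : CacheModel) {x y : CtrlState} (hE : y.E ≠ 0)
    (hS : x.O + x.I = y.O + y.I) (hx : x.I.card ≤ m.B) {n : ℕ}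
    (ht : ∀ k, 1 ≤ k → tail k y.I ≤ tail k x.I + n) {a : CacheAction} (ha : m.Feasible y a) :
    ∃ j ≤ m.gain x, j ≤ a.down.card ∧ ∀ k, 1 ≤ k → tail k (y.I + a.down - a.rem) ≤
      tail k (x.I + (m.swaps x (Finset.range j)).down - (m.swaps x (Finset.range j)).rem) + n := by
  rw [Feasible, if_neg hE] at ha
  obtain ⟨h1, h2, h3⟩ := ha
  refine ⟨min a.down.card (m.gain x), min_le_right _ _, min_le_left _ _, fun k hk => ?_⟩
  have h4 := m.min_le_tail_cache_swaps hx a.down.card hk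
  have h5 := ht k hk
  have h6 := tail_le_card k (y.I + a.down - a.rem)
  have h7 : tail k (y.I + a.down - a.rem) ≤ tail k (y.I + a.down) :=
    tail_mono k (Multiset.sub_le_self _ _)
  have h8 := tail_mono k h1
  have h9 := tail_le_card k a.down
  have h10 := congrArg (tail k) hS
  rw [tail_add] at h7
  rw [tail_add, tail_add] at h10
  omega

/-- Actions merely move contents across the cache boundary, so the total is independent of the
action. -/
theorem contents_nextCtrl (m : CacheModel) {x : CtrlState} {a : CacheAction} (hE : x.E ≠ 0)
    (ha : m.Feasible x a) (N : Multiset ℕ) (u : Bool) :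
    (nextCtrl x a N u).O + (nextCtrl x a N u).I = age (x.O + x.I) + N := by
  rw [Feasible, if_neg hE] at ha
  obtain ⟨h1, h2, -⟩ := ha
  have : x.O + a.rem - a.down + (x.I + a.down - a.rem) = x.O + x.I := by
    ext z
    have h3 := Multiset.count_le_of_le z h1
    have h4 := Multiset.count_le_of_le z h2
    simp only [Multiset.count_add, Multiset.count_sub]
    omega
  simp only [nextCtrl, if_neg hE]
  rw [← this, age_add]
  abel

/-- Couples two states through the same new contents and the same access event. The comparison `hf`
is a hypothesis so that the lemma can serve inside the induction that proves it. -/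
theorem nextExp_le_of_tail_le (m : CacheModel) {f : ℕ}
    (hf : ∀ {x y : CtrlState} {n : ℕ}, x.E = y.E → x.O + x.I = y.O + y.I → 0 ∉ x.O + x.I →
      x.I.card ≤ m.B → (∀ k, 1 ≤ k → tail k y.I ≤ tail k x.I + n) →
      m.cycleCost f x ≤ m.cycleCost f y + n * m.meanCost)
    {x y : CtrlState} {n : ℕ} (hE : x.E = y.E) (hE0 : x.E ≠ 0)
    (hS : x.O + x.I = y.O + y.I) {a b : CacheAction}
    (ha : m.Feasible x a) (hb : m.Feasible y b)
    (ht : ∀ k, 1 ≤ k → tail k (y.I + b.down - b.rem) ≤ tail k (x.I + a.down - a.rem) + n) :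
    m.nextExp (m.cycleCost f) x a ≤ m.nextExp (m.cycleCost f) y b + n * m.meanCost := by
  have hE1 : y.E ≠ 0 := hE ▸ hE0
  have : m.nextExp (m.cycleCost f) y b + n * m.meanCost =
      m.nextExp (fun z => m.cycleCost f z + n * m.meanCost) y b := by
    simp [nextExp, PMF.expect_add, PMF.expect_const]
  rw [this]
  unfold nextExp
  rw [hE]
  refine PMF.expect_mono _ fun N hN => PMF.expect_mono _ fun u hu => hf ?_ ?_ ?_ ?_ ?_
  · simp [nextCtrl, hE]
  · rw [m.contents_nextCtrl hE0 ha, m.contents_nextCtrl hE1 hb, hS]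
  · rw [m.contents_nextCtrl hE0 ha, Multiset.mem_add, not_or]
    refine ⟨zero_notMem_age _, fun h => ?_⟩
    exact absurd ((m.mem_support_newLaw hN).2 0 h).1 (by omega)
  · rw [Feasible, if_neg hE0] at ha
    simp only [nextCtrl, if_neg hE0]
    exact (card_age_le _).trans ha.2.2
  · intro k hk
    simp only [nextCtrl, if_neg hE0, if_neg hE1, tail_age hk]
    exact ht (k + 1) (by omega)

/-- Level `1` compares the cache sizes, and the totals agree. -/
theorem card_outside_le {x y : CtrlState} {n : ℕ} (hS : x.O + x.I = y.O + y.I)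
    (h0 : 0 ∉ x.O + x.I) (ht : ∀ k, 1 ≤ k → tail k y.I ≤ tail k x.I + n) :
    x.O.card ≤ y.O.card + n := by
  have h1 := ht 1 le_rfl
  rw [tail_one fun h => h0 (Multiset.mem_add.2 (Or.inr h)),
    tail_one fun h => h0 (hS ▸ Multiset.mem_add.2 (Or.inr h))] at h1
  have h2 := congrArg Multiset.card hS
  simp only [Multiset.card_add] at h2
  omega

/-- If two states have the same contents and the cache of the second one is, at all lifetime
levels, ahead of the first one by at most `n` contents, then the least costs differ by at most the
mean cost of `n` downloads. -/
theorem cycleCost_le_of_tail_le (m : CacheModel) (f : ℕ) {x y : CtrlState} {n : ℕ} (hE : x.E = y.E)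
    (hS : x.O + x.I = y.O + y.I) (h0 : 0 ∉ x.O + x.I) (hx : x.I.card ≤ m.B)
    (ht : ∀ k, 1 ≤ k → tail k y.I ≤ tail k x.I + n) :
    m.cycleCost f x ≤ m.cycleCost f y + n * m.meanCost := by
  have key {x y : CtrlState} {n : ℕ} (hS : x.O + x.I = y.O + y.I) (h0 : 0 ∉ x.O + x.I)
      (ht : ∀ k, 1 ≤ k → tail k y.I ≤ tail k x.I + n) :
      (x.O.card : ℝ≥0∞) * m.meanCost ≤ y.O.card * m.meanCost + n * m.meanCost := by
    rw [← add_mul]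
    gcongr
    exact_mod_cast card_outside_le hS h0 ht
  induction f generalizing x y n with
  | zero => exact key hS h0 ht
  | succ f ih =>
    by_cases hE0 : x.E = 0
    · rw [cycleCost_of_access _ _ hE0, cycleCost_of_access _ _ (hE ▸ hE0)]
      exact key hS h0 ht
    · have hE1 : y.E ≠ 0 := hE ▸ hE0
      have hx0 : 0 ∉ x.I := fun h => h0 (Multiset.mem_add.2 (Or.inr h))
      have hC := m.C_prob
      simp only [cycleCost, if_neg hE0, if_neg hE1]
      rw [show (n : ℝ≥0∞) * m.meanCost = ∫⁻ _, n * m.meanCost ∂m.lawC by simp,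
        ← lintegral_add_right _ measurable_const]
      refine lintegral_mono fun c => ?_
      simp only [ENNReal.iInf_add]
      refine le_iInf₂ fun b hb => ?_
      -- Imitation: `x` answers `b` with no more downloads and the tail gap stays at most `n`, so
      -- the extra `n * meanCost` is passed on to the next slot.
      obtain ⟨j, hj1, hj2, hj3⟩ := m.exists_swaps hE1 hS hx ht hb
      have hfs := m.feasible_swaps hE0 hx hx0 (hj1.trans (m.gain_le x))
      refine (iInf₂_le (m.swaps x (Finset.range j)) hfs).trans ?_
      rw [add_assoc]
      gcongr
      · unfold stageCost
        rw [m.card_swaps_down x hj1]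
        gcongr
      · exact m.nextExp_le_of_tail_le ih hE hE0 hS hfs hb hj3

/-- Waiting without any action until the access is feasible and leaves at most this many contents to
download. -/
theorem cycleCost_le (m : CacheModel) (f : ℕ) {x : CtrlState} (hx : x.I.card ≤ m.B) :
    m.cycleCost f x ≤ (x.O.card + f * m.Mmax : ℕ) * m.meanCost := by
  have hC := m.C_prob
  induction f generalizing x with
  | zero => simp [cycleCost]
  | succ f ih =>
    by_cases hE : x.E = 0
    · rw [cycleCost_of_access _ _ hE]
      gcongr
      omega
    · simp only [cycleCost, if_neg hE]
      have hfe : m.Feasible x ⟨0, 0⟩ := by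
        rw [Feasible, if_neg hE]
        exact ⟨Multiset.zero_le _, Multiset.zero_le _, by simpa using hx⟩
      calc _ ≤ ∫⁻ _, ((x.O.card + (f + 1) * m.Mmax : ℕ) * m.meanCost : ℝ≥0∞) ∂m.lawC := ?_
        _ = _ := by simp
      refine lintegral_mono fun c => (iInf₂_le _ hfe).trans ?_
      simp only [stageCost, Multiset.card_zero, Nat.cast_zero, zero_mul, zero_add]
      calc m.nextExp (m.cycleCost f) x ⟨0, 0⟩
          ≤ m.nextExp (fun _ => (x.O.card + (f + 1) * m.Mmax : ℕ) * m.meanCost) x ⟨0, 0⟩ :=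
            m.nextExp_mono fun N hN u hu => ?_
        _ = _ := by simp [nextExp, PMF.expect_const]
      refine (ih ?_).trans ?_
      · simp only [nextCtrl, if_neg hE, add_zero, Multiset.sub_zero]
        exact (card_age_le _).trans hx
      · have h1 := card_age_le x.O
        have h2 := (m.mem_support_newLaw hN).1
        have h3 : (nextCtrl x ⟨0, 0⟩ N u).O.card ≤ x.O.card + m.Mmax := by
          simp only [nextCtrl, if_neg hE, add_zero, Multiset.sub_zero, Multiset.card_add]
          omega
        have h4 : (nextCtrl x ⟨0, 0⟩ N u).O.card + f * m.Mmax ≤ x.O.card + (f + 1) * m.Mmax := by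
          rw [add_mul, one_mul]; omega
        gcongr

end CacheModel

/-! ### Thresholds from a one-parameter minimization -/

/-- The largest minimizer of `j * c + g j` over `j ≤ G` is a threshold function of `c`. -/
theorem exists_antitone_minimizer (g : ℕ → ℝ) (G : ℕ) (C : ℝ) (hC : 0 ≤ C)
    (hg : ∀ j ≤ G, 0 < j → g 0 < j * C + g j) :
    ∃ n : ℝ → ℕ, Antitone n ∧ (∀ c, n c ≤ G) ∧
      (∀ c, ∀ j ≤ G, n c * max c 0 + g (n c) ≤ j * max c 0 + g j) ∧
      ∃ T : ℕ → ℝ, (∀ i j, i ≤ j → j < n 0 → T j ≤ T i) ∧ (∀ i < n 0, T i < C) ∧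
        ∀ c i, i < n c ↔ i < n 0 ∧ c ≤ T i := by
  classical
  -- `max c 0` matches the truncation of negative costs by `ENNReal.ofReal`.
  let opt : ℝ → Finset ℕ := fun c => (Finset.range (G + 1)).filter fun j =>
    ∀ j' ≤ G, j * max c 0 + g j ≤ j' * max c 0 + g j'
  have mem_opt (c : ℝ) (j : ℕ) :
      j ∈ opt c ↔ j ≤ G ∧ ∀ j' ≤ G, j * max c 0 + g j ≤ j' * max c 0 + g j' := by
    simp [opt]
  have hne (c : ℝ) : (opt c).Nonempty := by
    obtain ⟨j, hj, hmin⟩ := Finset.exists_min_image (Finset.range (G + 1))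
      (fun j => (j : ℝ) * max c 0 + g j) ⟨0, by simp⟩
    exact ⟨j, (mem_opt c j).2 ⟨by simpa [Nat.lt_succ_iff] using hj,
      fun j' hj' => hmin j' (by simpa [Nat.lt_succ_iff] using hj')⟩⟩
  let n : ℝ → ℕ := fun c => (opt c).max' (hne c)
  have hn (c : ℝ) : n c ∈ opt c := Finset.max'_mem _ _
  have hle (c : ℝ) (j : ℕ) (hj : j ∈ opt c) : j ≤ n c := Finset.le_max' _ _ hj
  have hanti : Antitone n := by
    intro c c' hcc
    by_contra! hlt
    obtain ⟨h1, h2⟩ := (mem_opt _ _).1 (hn c)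
    obtain ⟨h3, h4⟩ := (mem_opt _ _).1 (hn c')
    refine absurd (hle c (n c') ((mem_opt _ _).2 ⟨h3, fun j' hj' => ?_⟩)) (not_le.2 hlt)
    have h5 := h4 (n c) h1
    have h6 := h2 j' hj'
    have h7 : (n c : ℝ) ≤ n c' := by exact_mod_cast hlt.le
    have h8 : max c 0 ≤ max c' 0 := max_le_max_right 0 hcc
    -- Lowering the cost favors the larger number: `n c'` beats `n c` at cost `c'`, hence also at
    -- `c`, contradicting maximality of `n c`.
    nlinarith [mul_nonneg (sub_nonneg.2 h7) (sub_nonneg.2 h8)]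
  have hneg (c : ℝ) (hc : c ≤ 0) : n c = n 0 := by
    have : opt c = opt 0 := by simp only [opt, max_eq_right hc, max_self]
    simp only [n, this]
  have hzero (c : ℝ) (hc : C ≤ c) : n c = 0 := by
    by_contra h
    obtain ⟨h1, h2⟩ := (mem_opt _ _).1 (hn c)
    have h3 := h2 0 (Nat.zero_le _)
    have h4 := hg _ h1 (Nat.pos_of_ne_zero h)
    rw [max_eq_left (hC.trans hc)] at h3
    have h5 : (n c : ℝ) * C ≤ n c * c := by gcongr
    simp only [Nat.cast_zero, zero_mul, zero_add] at h3
    linarith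
  -- Taking the largest minimizer makes this a finite union of closed optimality sets, so the
  -- supremum is attained and the threshold condition is `c ≤ T i`.
  have hclosed (i : ℕ) : IsClosed {c | i < n c} := by
    have : {c | i < n c} = ⋃ j ∈ (Finset.range (G + 1)).filter (fun j => i < j),
        ⋂ j', ⋂ (_ : j' ≤ G), {c : ℝ | (j : ℝ) * max c 0 + g j ≤ j' * max c 0 + g j'} := by
      ext c
      simp only [Set.mem_ofPred_eq, Set.mem_iUnion, Set.mem_iInter, Finset.mem_filter,
        Finset.mem_range, Nat.lt_succ_iff, exists_prop]
      constructor
      · intro h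
        have := (mem_opt _ _).1 (hn c)
        exact ⟨n c, ⟨this.1, h⟩, this.2⟩
      · rintro ⟨j, ⟨h1, h2⟩, h3⟩
        exact h2.trans_le (hle c j ((mem_opt _ _).2 ⟨h1, h3⟩))
    rw [this]
    refine isClosed_biUnion_finset fun j _ => isClosed_iInter fun j' => isClosed_iInter fun _ => ?_
    exact isClosed_le (by fun_prop) (by fun_prop)
  have hbdd (i : ℕ) : BddAbove {c | i < n c} := by
    refine ⟨C, fun c hc => ?_⟩
    by_contra! h
    have : i < n c := hc
    rw [hzero c h.le] at this
    omega
  have hmem (i : ℕ) (hi : i < n 0) : i < n (sSup {c | i < n c}) :=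
    (hclosed i).csSup_mem ⟨0, hi⟩ (hbdd i)
  refine ⟨n, hanti, fun c => ((mem_opt _ _).1 (hn c)).1, fun c => ((mem_opt _ _).1 (hn c)).2,
    fun i => sSup {c | i < n c}, fun i j hij hj => le_csSup (hbdd i) (hij.trans_lt (hmem j hj)),
    fun i hi => ?_, fun c i => ⟨fun h => ⟨?_, le_csSup (hbdd i) h⟩, fun h => ?_⟩⟩
  · by_contra! h
    have := hmem i hi
    rw [hzero _ h] at this
    omega
  · rcases le_total c 0 with hc | hc
    · rwa [hneg c hc] at h
    · exact h.trans_le (hanti hc)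
  · exact (hmem i h.1).trans_le (hanti h.2)

/-! ### The threshold policy and the Bellman inequalities -/

namespace CacheModel

/-- Strict because a continuous law gives no mass to the point `Cmax`. -/
theorem meanCost_lt (m : CacheModel) : m.meanCost < ENNReal.ofReal m.Cmax := by
  have hC := m.C_prob
  have hN := m.C_cont
  have h1 : ∀ᵐ c ∂m.lawC, c ≠ m.Cmax := by
    rw [ae_iff]; simp
  have h2 : ∀ᵐ c ∂m.lawC, ENNReal.ofReal c < ENNReal.ofReal m.Cmax := by
    filter_upwards [h1, m.C_mem] with c hc hc'
    have hlt := lt_of_le_of_ne hc'.2 hc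
    exact (ENNReal.ofReal_lt_ofReal_iff (hc'.1.trans_lt hlt)).2 hlt
  have h3 : ∫⁻ _, ENNReal.ofReal m.Cmax ∂m.lawC = ENNReal.ofReal m.Cmax := by simp
  have h4 : m.meanCost ≠ ∞ := by
    refine ne_top_of_le_ne_top (ENNReal.ofReal_ne_top (r := m.Cmax)) ?_
    rw [← h3]
    exact lintegral_mono_ae (h2.mono fun _ h => h.le)
  rw [← h3]
  exact lintegral_strict_mono (IsProbabilityMeasure.ne_zero _) aemeasurable_const h4 h2

theorem Cmax_pos (m : CacheModel) : 0 < m.Cmax :=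
  ENNReal.ofReal_pos.1 (zero_le.trans_lt m.meanCost_lt)

theorem IsState.E_lt_Dmax {m : CacheModel} {x : CtrlState} (hx : m.IsState x) : x.E < m.Dmax := by
  obtain ⟨d, hd, h⟩ := hx.E_lt
  exact h.trans_le (m.D_le d hd)

theorem IsState.zero_notMem {m : CacheModel} {x : CtrlState} (hx : m.IsState x) :
    0 ∉ x.O + x.I := by
  rw [Multiset.mem_add, not_or]
  exact ⟨fun h => absurd (hx.O_mem 0 h).1 (by omega), fun h => absurd (hx.I_mem 0 h).1 (by omega)⟩

/-- The least expected cost until the next user access. -/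
noncomputable def value (m : CacheModel) (x : CtrlState) : ℝ≥0∞ := m.cycleCost (m.Dmax - x.E) x

/-- The horizon `Dmax - E` drops by one in step with `E`; after an access the horizon is irrelevant.
-/
theorem nextExp_value (m : CacheModel) {x : CtrlState} {f : ℕ} (hf : m.Dmax - x.E = f + 1)
    (a : CacheAction) : m.nextExp m.value x a = m.nextExp (m.cycleCost f) x a := by
  refine m.nextExp_congr fun N _ u _ => ?_
  cases u with
  | true =>
    have h : (nextCtrl x a N true).E = 0 := rfl
    rw [value, cycleCost_of_access _ _ h, cycleCost_of_access _ _ h]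
  | false =>
    have h : m.Dmax - (nextCtrl x a N false).E = f := by
      change m.Dmax - (x.E + 1) = f
      omega
    rw [value, h]

theorem exists_fuel {m : CacheModel} {x : CtrlState} (hx : m.IsState x) :
    ∃ f, m.Dmax - x.E = f + 1 :=
  ⟨m.Dmax - x.E - 1, by have := hx.E_lt_Dmax; omega⟩

theorem value_le {m : CacheModel} {x : CtrlState} (hx : m.IsState x) :
    m.value x ≤ (x.O.card + m.Dmax * m.Mmax : ℕ) * m.meanCost := by
  refine (m.cycleCost_le _ hx.card_le).trans ?_
  gcongr
  exact Nat.sub_le _ _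

theorem nextExp_value_ne_top {m : CacheModel} {x : CtrlState} (hx : m.IsState x) (hE : x.E ≠ 0)
    {a : CacheAction} (ha : m.Feasible x a) : m.nextExp m.value x a ≠ ∞ := by
  have h : m.nextExp m.value x a ≤ m.nextExp
      (fun _ => (x.O.card + x.I.card + m.Mmax + m.Dmax * m.Mmax : ℕ) * m.meanCost) x a := by
    refine m.nextExp_mono fun N hN u hu => (value_le (m.isState_nextCtrl hx ha hN hu)).trans ?_
    have h1 := (m.mem_support_newLaw hN).1
    have h2 := congrArg Multiset.card (m.contents_nextCtrl hE ha N u)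
    have h3 := card_age_le (x.O + x.I)
    simp only [Multiset.card_add] at h2 h3
    have h4 : (nextCtrl x a N u).O.card ≤ x.O.card + x.I.card + m.Mmax := by omega
    gcongr
  refine ne_top_of_le_ne_top ?_ h
  simp only [nextExp, PMF.expect_const]
  exact ENNReal.mul_ne_top (ENNReal.natCast_ne_top _) (m.meanCost_lt.trans_le le_top).ne

theorem exists_threshold_swaps (m : CacheModel) (x : CtrlState) :
    ∃ n : ℝ → ℕ, Antitone n ∧ (∀ c, n c ≤ m.gain x) ∧ (m.IsState x → x.E ≠ 0 →
      (∀ c a, m.Feasible x a →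
        stageCost (x, c) (m.swaps x (Finset.range (n c))) +
            m.nextExp m.value x (m.swaps x (Finset.range (n c))) ≤
          stageCost (x, c) a + m.nextExp m.value x a) ∧
      ∃ T : ℕ → ℝ, (∀ i j, i ≤ j → j < n 0 → T j ≤ T i) ∧ (∀ i < n 0, T i < m.Cmax) ∧
        ∀ c i, i < n c ↔ i < n 0 ∧ c ≤ T i) := by
  by_cases h : m.IsState x ∧ x.E ≠ 0
  swap
  -- A dummy choice that keeps monotonicity, and hence measurability of the policy, valid for every
  -- `x`.
  · exact ⟨fun _ => 0, antitone_const, fun _ => Nat.zero_le _, fun h1 h2 => absurd ⟨h1, h2⟩ h⟩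
  obtain ⟨hx, hE⟩ := h
  obtain ⟨f, hf⟩ := exists_fuel hx
  have hx0 : 0 ∉ x.I := fun h => hx.zero_notMem (Multiset.mem_add.2 (Or.inr h))
  have hfe {j : ℕ} (hj : j ≤ m.gain x) := m.feasible_swaps hE hx.card_le hx0 (hj.trans (m.gain_le x))
  let Q : ℕ → ℝ≥0∞ := fun j => m.nextExp m.value x (m.swaps x (Finset.range j))
  have hQ {j : ℕ} (hj : j ≤ m.gain x) : Q j ≠ ∞ := nextExp_value_ne_top hx hE (hfe hj)
  have key {j : ℕ} {c : ℝ} (hj : j ≤ m.gain x) :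
      ENNReal.ofReal (j * max c 0 + (Q j).toReal) =
        stageCost (x, c) (m.swaps x (Finset.range j)) + Q j := by
    rw [ENNReal.ofReal_add (by positivity) ENNReal.toReal_nonneg, ENNReal.ofReal_toReal (hQ hj),
      ENNReal.ofReal_mul (by positivity), ENNReal.ofReal_natCast, stageCost,
      m.card_swaps_down x hj]
    simp
  obtain ⟨n, h1, h2, h3, h4⟩ := exists_antitone_minimizer (fun j => (Q j).toReal) (m.gain x) m.Cmax
    m.Cmax_pos.le (by
      intro j hj hj0
      -- `j` simple actions raise each tail by at most `j`, so they save at most `j` mean download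
      -- costs; at cost `Cmax` they do not pay.
      have h5 : Q 0 ≤ Q j + j * m.meanCost := by
        simp only [Q, m.nextExp_value hf]
        refine m.nextExp_le_of_tail_le (m.cycleCost_le_of_tail_le f) rfl hE rfl (hfe (Nat.zero_le _))
          (hfe hj) fun k hk => ?_
        rw [m.tail_cache_swaps hx.card_le (hj.trans (m.gain_le x)) hk,
          m.tail_cache_swaps hx.card_le (Nat.zero_le _) hk]
        omega
      have h6 : m.meanCost ≠ ∞ := (m.meanCost_lt.trans_le le_top).ne
      have h7 := ENNReal.toReal_mono
        (ENNReal.add_ne_top.2 ⟨hQ hj, ENNReal.mul_ne_top (ENNReal.natCast_ne_top _) h6⟩) h5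
      rw [ENNReal.toReal_add (hQ hj) (ENNReal.mul_ne_top (ENNReal.natCast_ne_top _) h6),
        ENNReal.toReal_mul, ENNReal.toReal_natCast] at h7
      have h8 : m.meanCost.toReal < m.Cmax := by
        have := (ENNReal.toReal_lt_toReal h6 ENNReal.ofReal_ne_top).2 m.meanCost_lt
        rwa [ENNReal.toReal_ofReal m.Cmax_pos.le] at this
      have h9 : (j : ℝ) * m.meanCost.toReal < j * m.Cmax := by gcongr
      linarith)
  refine ⟨n, h1, h2, fun _ _ => ⟨fun c a ha => ?_, h4⟩⟩
  -- The comparison of `x` with itself, with gap `0`: any action is dominated by some first simple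
  -- actions.
  obtain ⟨j, hj1, hj2, hj3⟩ := m.exists_swaps hE rfl hx.card_le (n := 0) (fun k _ => le_rfl) ha
  calc stageCost (x, c) (m.swaps x (Finset.range (n c))) + Q (n c)
      ≤ stageCost (x, c) (m.swaps x (Finset.range j)) + Q j := by
        rw [← key (h2 c), ← key hj1]
        exact ENNReal.ofReal_le_ofReal (h3 c j hj1)
    _ ≤ stageCost (x, c) a + m.nextExp m.value x a := by
        gcongr
        · unfold stageCost
          rw [m.card_swaps_down x hj1]
          gcongr
        · simp only [Q, m.nextExp_value hf]
          simpa using m.nextExp_le_of_tail_le (m.cycleCost_le_of_tail_le f) rfl hE rfl (hfe hj1) ha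
            (n := 0) hj3

/-- The number of simple actions in the threshold policy. -/
noncomputable def numSwaps (m : CacheModel) (x : CtrlState) : ℝ → ℕ :=
  (m.exists_threshold_swaps x).choose

open Classical in
/-- The threshold policy. The last branch concerns only states that cannot occur. -/
noncomputable def thresholdAct (m : CacheModel) (s : CacheState) : CacheAction :=
  if s.1.E = 0 then ⟨s.1.O, s.1.I⟩
  else if m.IsState s.1 then m.swaps s.1 (Finset.range (m.numSwaps s.1 s.2))
  else ⟨0, s.1.I⟩

noncomputable def thresholdPolicy (m : CacheModel) : m.StationaryPolicy where
  act := m.thresholdAct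
  measurable := by
    refine measurable_from_prod_countable_right fun x => ?_
    unfold thresholdAct
    by_cases h1 : x.E = 0
    · simp only [if_pos h1, measurable_const]
    by_cases h2 : m.IsState x
    swap
    · simp only [if_neg h1, if_neg h2, measurable_const]
    simp only [if_neg h1, if_pos h2]
    exact (measurable_of_countable fun n : ℕ => m.swaps x (Finset.range n)).comp
      (m.exists_threshold_swaps x).choose_spec.1.measurable
  feasible s := by
    unfold thresholdAct
    split_ifs with h1 h2
    · simp [Feasible, h1]
    · exact m.feasible_swaps h1 h2.card_le
        (fun h => h2.zero_notMem (Multiset.mem_add.2 (Or.inr h)))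
        (((m.exists_threshold_swaps s.1).choose_spec.2.1 s.2).trans (m.gain_le _))
    -- Emptying the cache is feasible even if it holds more than `B` contents.
    · simp [Feasible, h1]

/-- The least expected cost until the next user access, given the current channel cost. -/
noncomputable def stateValue (m : CacheModel) (s : CacheState) : ℝ≥0∞ :=
  if s.1.E = 0 then s.1.O.card * ENNReal.ofReal s.2
  else ⨅ (a : CacheAction) (_ : m.Feasible s.1 a), stageCost s a + m.nextExp m.value s.1 a

theorem measurable_stageCost : Measurable fun q : CacheState × CacheAction => stageCost q.1 q.2 := by
  have : Measurable fun a : CacheAction => (a.down.card : ℝ≥0∞) := measurable_of_countable _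
  exact (this.comp measurable_snd).mul
    (ENNReal.measurable_ofReal.comp (measurable_snd.comp measurable_fst))

theorem measurable_stateValue (m : CacheModel) : Measurable m.stateValue := by
  refine measurable_from_prod_countable_right fun x => ?_
  unfold stateValue
  by_cases hE : x.E = 0
  · simp only [if_pos hE]
    exact ENNReal.measurable_ofReal.const_mul _
  · simp only [if_neg hE]
    refine Measurable.iInf fun a => Measurable.iInf (ι := m.Feasible x a) fun _ => ?_
    exact (ENNReal.measurable_ofReal.const_mul _).add_const _

theorem lintegral_stateValue {m : CacheModel} {x : CtrlState} (hx : m.IsState x) :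
    ∫⁻ c, m.stateValue (x, c) ∂m.lawC = m.value x := by
  by_cases hE : x.E = 0
  · rw [value, cycleCost_of_access _ _ hE]
    simp only [stateValue, if_pos hE]
    rw [lintegral_const_mul _ (by fun_prop)]
    rfl
  · obtain ⟨f, hf⟩ := exists_fuel hx
    rw [value, hf]
    simp only [stateValue, cycleCost, if_neg hE, m.nextExp_value hf]

/-- The least expected cost of a whole cycle. -/
noncomputable def renewalCost (m : CacheModel) : ℝ≥0∞ := m.nextExp m.value ⟨0, 0, 0⟩ ⟨0, 0⟩

/-- The renewal property: an access erases the state. -/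
theorem nextExp_of_access (m : CacheModel) (f : CtrlState → ℝ≥0∞) {x : CtrlState} (hE : x.E = 0)
    (a : CacheAction) : m.nextExp f x a = m.nextExp f ⟨0, 0, 0⟩ ⟨0, 0⟩ := by
  simp only [nextExp, nextCtrl, hE]
  rfl

/-- `stateValue` ends with the coming access, so an access slot must be credited with `renewalCost`
for the cycle that it opens. -/
theorem stateValue_add_le (m : CacheModel) (s : CacheState) {a : CacheAction}
    (ha : m.Feasible s.1 a) : m.stateValue s + (if s.1.E = 0 then m.renewalCost else 0) ≤
      stageCost s a + m.nextExp m.value s.1 a := by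
  by_cases hE : s.1.E = 0
  · rw [Feasible, if_pos hE] at ha
    simp only [stateValue, if_pos hE, stageCost, ha.1, m.nextExp_of_access _ hE a, renewalCost]
    rfl
  · simp only [stateValue, if_neg hE, add_zero]
    exact iInf₂_le a ha

theorem le_stateValue_add {m : CacheModel} {s : CacheState} (hs : m.IsState s.1) :
    stageCost s (m.thresholdAct s) + m.nextExp m.value s.1 (m.thresholdAct s) ≤
      m.stateValue s + (if s.1.E = 0 then m.renewalCost else 0) := by
  by_cases hE : s.1.E = 0
  · simp only [stateValue, if_pos hE, stageCost, m.nextExp_of_access _ hE, renewalCost,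
      thresholdAct]
    rfl
  · simp only [stateValue, if_neg hE, add_zero, thresholdAct, if_pos hs]
    exact le_iInf₂ fun a ha => ((m.exists_threshold_swaps s.1).choose_spec.2.2 hs hE).1 s.2 a ha

/-! ### Laws of histories -/

instance (m : CacheModel) : IsMarkovKernel m.ctrlKernel :=
  ⟨fun p => inferInstanceAs (IsProbabilityMeasure (m.ctrlLaw p.1 p.2).toMeasure)⟩

instance (m : CacheModel) : IsProbabilityMeasure m.lawC := m.C_prob

instance (m : CacheModel) : IsMarkovKernel m.stateKernel := by
  unfold stateKernel
  infer_instance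

instance (m : CacheModel) (p : m.Policy) (t : ℕ) : IsMarkovKernel (p.act t) := p.markov t

theorem lintegral_stateKernel (m : CacheModel) (s : CacheState) (a : CacheAction)
    {f : CacheState → ℝ≥0∞} (hf : Measurable f) :
    ∫⁻ y, f y ∂m.stateKernel (s, a) = m.nextExp (fun x => ∫⁻ c, f (x, c) ∂m.lawC) s.1 a := by
  rw [stateKernel, Kernel.lintegral_prod _ _ _ hf, ← lintegral_ctrlLaw]
  rfl

/-- The history extended by one slot. -/
def extendHist {t : ℕ} (q : (CacheHist t × CacheAction) × CacheState) : CacheHist (t + 1) :=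
  (Fin.snoc (α := fun _ => CacheState × CacheAction) q.1.1.1 (q.1.1.2, q.1.2), q.2)

theorem measurable_extendHist (t : ℕ) : Measurable (extendHist (t := t)) := by
  refine Measurable.prodMk (measurable_pi_iff.2 fun i => ?_) measurable_snd
  induction i using Fin.lastCases with
  | last => simp only [Fin.snoc_last]; fun_prop
  | cast i => simp only [Fin.snoc_castSucc]; fun_prop

theorem histLaw_succ (m : CacheModel) (p : m.Policy) (s₀ : CacheState) (t : ℕ) :
    m.histLaw p s₀ (t + 1) = ((m.histLaw p s₀ t ⊗ₘ p.act t) ⊗ₘ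
      (m.stateKernel.comap (fun q : CacheHist t × CacheAction => (q.1.2, q.2))
        ((measurable_snd.comp measurable_fst).prodMk measurable_snd))).map extendHist := rfl

instance (m : CacheModel) (p : m.Policy) (s₀ : CacheState) (t : ℕ) :
    IsProbabilityMeasure (m.histLaw p s₀ t) := by
  induction t with
  | zero => exact Measure.dirac.isProbabilityMeasure
  | succ t ih =>
    rw [histLaw_succ]
    exact Measure.isProbabilityMeasure_map (measurable_extendHist t).aemeasurable

theorem lintegral_histLaw_succ (m : CacheModel) (p : m.Policy) (s₀ : CacheState) (t : ℕ)
    {f : CacheHist (t + 1) → ℝ≥0∞} (hf : Measurable f) :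
    ∫⁻ h, f h ∂m.histLaw p s₀ (t + 1) = ∫⁻ h, ∫⁻ a, ∫⁻ s, f (extendHist ((h, a), s))
      ∂m.stateKernel (h.2, a) ∂p.act t h ∂m.histLaw p s₀ t := by
  have hf' : Measurable fun q => f (extendHist (t := t) q) := hf.comp (measurable_extendHist t)
  rw [histLaw_succ, lintegral_map hf (measurable_extendHist t), Measure.lintegral_compProd hf',
    Measure.lintegral_compProd]
  · rfl
  · exact hf'.lintegral_kernel_prod_right'

/-! ### Boundedness of the contents -/

/-- An invariant of the controlled state that bounds the number of relevant contents. -/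
def Bounded (m : CacheModel) (n : ℕ) (x : CtrlState) : Prop :=
  m.IsState x ∧ x.O.card + x.I.card ≤ n + m.Mmax * (if x.E = 0 then m.Dmax else x.E)

/-- Each slot adds at most `Mmax` contents. An access slot still holds those of a whole cycle, hence
the factor `Dmax` there; afterwards only new ones remain. -/
theorem bounded_nextCtrl (m : CacheModel) {n : ℕ} {x : CtrlState} (hx : m.Bounded n x)
    {a : CacheAction} (ha : m.Feasible x a) {N : Multiset ℕ} (hN : N ∈ m.newLaw.support) {u : Bool}
    (hu : u ∈ (m.accessLaw x.E).support) : m.Bounded n (nextCtrl x a N u) := by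
  refine ⟨m.isState_nextCtrl hx.1 ha hN hu, ?_⟩
  have h1 := (m.mem_support_newLaw hN).1
  have h2 := hx.1.E_lt_Dmax
  have h3 : x.E + 1 ≤ (if (nextCtrl x a N u).E = 0 then m.Dmax else (nextCtrl x a N u).E) := by
    cases u <;> simp [nextCtrl]; omega
  have h4 : (nextCtrl x a N u).O.card + (nextCtrl x a N u).I.card ≤ n + m.Mmax * (x.E + 1) := by
    by_cases hE : x.E = 0
    · simp only [nextCtrl, hE, if_true, Multiset.card_zero]
      omega
    · have h5 := congrArg Multiset.card (m.contents_nextCtrl hE ha N u)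
      have h6 := card_age_le (x.O + x.I)
      have h7 := hx.2
      rw [if_neg hE] at h7
      simp only [Multiset.card_add] at h5 h6
      rw [mul_add, mul_one]
      omega
  exact h4.trans (by gcongr)

theorem ae_bounded (m : CacheModel) (p : m.Policy) {s₀ : CacheState} {n : ℕ}
    (h₀ : m.Bounded n s₀.1) (t : ℕ) : ∀ᵐ h ∂m.histLaw p s₀ t, m.Bounded n h.2.1 := by
  classical
  induction t with
  | zero =>
    exact (ae_dirac_iff ((measurable_fst.comp measurable_snd)
      (MeasurableSet.of_discrete (s := {x | m.Bounded n x})))).2 h₀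
  | succ t ih =>
    -- The indicator of failure: its integral vanishes by the one-step formula.
    let g : CtrlState → ℝ≥0∞ := fun x => if m.Bounded n x then 0 else 1
    have hg : Measurable fun h : CacheHist (t + 1) => g h.2.1 :=
      (measurable_of_countable g).comp (measurable_fst.comp measurable_snd)
    have hg' : Measurable fun s : CacheState => g s.1 :=
      (measurable_of_countable g).comp measurable_fst
    have h1 : ∫⁻ h, g h.2.1 ∂m.histLaw p s₀ (t + 1) = 0 := by
      rw [lintegral_histLaw_succ m p s₀ t hg, lintegral_eq_zero_of_ae_eq_zero]
      filter_upwards [ih] with h hh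
      refine lintegral_eq_zero_of_ae_eq_zero ?_
      filter_upwards [p.feasible t h] with a ha
      change ∫⁻ s, g s.1 ∂m.stateKernel (h.2, a) = 0
      rw [lintegral_stateKernel m h.2 a hg']
      have h2 : m.nextExp (fun x => ∫⁻ _, g x ∂m.lawC) h.2.1 a =
          m.nextExp (fun _ => 0) h.2.1 a := by
        refine m.nextExp_congr fun N hN u hu => ?_
        simp [g, m.bounded_nextCtrl hh ha hN hu]
      exact h2.trans (by simp [nextExp, PMF.expect_const])
    filter_upwards [(lintegral_eq_zero_iff hg).1 h1] with h hh
    by_contra hn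
    simp [g, hn] at hh

/-! ### Comparison of policies -/

/-- The cost of the slots of a history. -/
noncomputable def histCost {t : ℕ} (h : CacheHist t) : ℝ≥0∞ :=
  ∑ i, stageCost (h.1 i).1 (h.1 i).2

theorem measurable_histCost (t : ℕ) : Measurable (histCost (t := t)) :=
  Finset.measurable_sum _ fun i _ =>
    measurable_stageCost.comp ((measurable_pi_apply i).comp measurable_fst)

theorem histCost_extendHist {t : ℕ} (h : CacheHist t) (a : CacheAction) (s : CacheState) :
    histCost (extendHist ((h, a), s)) = histCost h + stageCost h.2 a := by
  simp [histCost, extendHist, Fin.sum_univ_castSucc]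

/-- The cost so far plus the value of the current state. -/
noncomputable def costToAccess (m : CacheModel) (p : m.Policy) (s₀ : CacheState) (t : ℕ) : ℝ≥0∞ :=
  ∫⁻ h, (histCost h + m.stateValue h.2) ∂m.histLaw p s₀ t

theorem measurable_histCost_add (m : CacheModel) (t : ℕ) :
    Measurable fun h : CacheHist t => histCost h + m.stateValue h.2 :=
  (measurable_histCost t).add (m.measurable_stateValue.comp measurable_snd)

theorem costToAccess_zero (m : CacheModel) (p : m.Policy) (s₀ : CacheState) :
    m.costToAccess p s₀ 0 = m.stateValue s₀ := by
  unfold costToAccess histLaw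
  rw [lintegral_dirac' _ (m.measurable_histCost_add 0)]
  simp [histCost]

theorem nextExp_lintegral_stateValue (m : CacheModel) {x : CtrlState} {a : CacheAction}
    (hx : m.IsState x) (ha : m.Feasible x a) :
    m.nextExp (fun y => ∫⁻ c, m.stateValue (y, c) ∂m.lawC) x a = m.nextExp m.value x a :=
  m.nextExp_congr fun _ hN _ hu => lintegral_stateValue (m.isState_nextCtrl hx ha hN hu)

theorem costToAccess_succ (m : CacheModel) (p : m.Policy) {s₀ : CacheState} {n : ℕ}
    (h₀ : m.Bounded n s₀.1) (t : ℕ) : m.costToAccess p s₀ (t + 1) =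
      ∫⁻ h, (histCost h + ∫⁻ a, (stageCost h.2 a + m.nextExp m.value h.2.1 a) ∂p.act t h)
        ∂m.histLaw p s₀ t := by
  unfold costToAccess
  rw [lintegral_histLaw_succ m p s₀ t (m.measurable_histCost_add _)]
  refine lintegral_congr_ae ?_
  filter_upwards [m.ae_bounded p h₀ t] with h hh
  have h1 : ∫⁻ _, histCost h ∂p.act t h = histCost h := by simp
  rw [← h1, ← lintegral_add_left measurable_const]
  refine lintegral_congr_ae ?_
  filter_upwards [p.feasible t h] with a ha
  simp_rw [histCost_extendHist]
  change ∫⁻ s, (histCost h + stageCost h.2 a + m.stateValue s) ∂m.stateKernel (h.2, a) = _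
  rw [lintegral_add_left measurable_const, lintegral_stateKernel _ _ _ m.measurable_stateValue,
    m.nextExp_lintegral_stateValue hh.1 ha]
  simp [add_assoc]

/-- The probability of a user access in slot `t`, under a policy. -/
noncomputable def accessProb (m : CacheModel) (p : m.Policy) (s₀ : CacheState) (t : ℕ) : ℝ≥0∞ :=
  ∫⁻ h, (if h.2.1.E = 0 then 1 else 0) ∂m.histLaw p s₀ t

theorem lintegral_elapsed_succ (m : CacheModel) (p : m.Policy) (s₀ : CacheState) (t : ℕ)
    (φ : ℕ → ℝ≥0∞) : ∫⁻ h, φ h.2.1.E ∂m.histLaw p s₀ (t + 1) =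
      ∫⁻ h, (m.accessLaw h.2.1.E).expect (fun u => φ (if u then 0 else h.2.1.E + 1))
        ∂m.histLaw p s₀ t := by
  have hg : Measurable fun s : CacheState => φ s.1.E :=
    (measurable_of_countable fun x : CtrlState => φ x.E).comp measurable_fst
  have hg' : Measurable fun h : CacheHist (t + 1) => φ h.2.1.E := hg.comp measurable_snd
  rw [lintegral_histLaw_succ m p s₀ t hg']
  refine lintegral_congr fun h => ?_
  have h1 (a : CacheAction) : ∫⁻ s, φ s.1.E ∂m.stateKernel (h.2, a) =
      (m.accessLaw h.2.1.E).expect (fun u => φ (if u then 0 else h.2.1.E + 1)) := by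
    rw [lintegral_stateKernel m h.2 a hg]
    simp [nextExp, nextCtrl, PMF.expect_const]
  change ∫⁻ a, ∫⁻ s, φ s.1.E ∂m.stateKernel (h.2, a) ∂p.act t h = _
  simp [h1]

/-- The law of the elapsed times does not depend on the policy. -/
theorem lintegral_elapsed_eq (m : CacheModel) (p q : m.Policy) (s₀ : CacheState) (t : ℕ)
    (φ : ℕ → ℝ≥0∞) :
    ∫⁻ h, φ h.2.1.E ∂m.histLaw p s₀ t = ∫⁻ h, φ h.2.1.E ∂m.histLaw q s₀ t := by
  -- One step back, `φ` is replaced by its conditional expectation, again a function of `E` alone.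
  induction t generalizing φ with
  | zero => rfl
  | succ t ih =>
    rw [lintegral_elapsed_succ, lintegral_elapsed_succ]
    exact ih fun e => (m.accessLaw e).expect fun u => φ (if u then 0 else e + 1)

theorem accessProb_eq (m : CacheModel) (p q : m.Policy) (s₀ : CacheState) (t : ℕ) :
    m.accessProb p s₀ t = m.accessProb q s₀ t :=
  m.lintegral_elapsed_eq p q s₀ t fun e => if e = 0 then 1 else 0

theorem costToAccess_add (m : CacheModel) (p : m.Policy) (s₀ : CacheState) (t : ℕ) :
    m.costToAccess p s₀ t + m.renewalCost * m.accessProb p s₀ t =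
      ∫⁻ h, (histCost h + (m.stateValue h.2 + if h.2.1.E = 0 then m.renewalCost else 0))
        ∂m.histLaw p s₀ t := by
  have h1 : Measurable fun h : CacheHist t => (if h.2.1.E = 0 then (1 : ℝ≥0∞) else 0) :=
    (measurable_of_countable fun x : CtrlState => (if x.E = 0 then (1 : ℝ≥0∞) else 0)).comp
      (measurable_fst.comp measurable_snd)
  unfold costToAccess accessProb
  rw [← lintegral_const_mul _ h1, ← lintegral_add_right _ (h1.const_mul _)]
  simp [add_assoc]

theorem costToAccess_add_le (m : CacheModel) (p : m.Policy) {s₀ : CacheState} {n : ℕ}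
    (h₀ : m.Bounded n s₀.1) (t : ℕ) :
    m.costToAccess p s₀ t + m.renewalCost * m.accessProb p s₀ t ≤ m.costToAccess p s₀ (t + 1) := by
  rw [costToAccess_add, m.costToAccess_succ p h₀]
  refine lintegral_mono fun h => add_le_add_right ?_ _
  have h1 (b : ℝ≥0∞) : ∫⁻ _, b ∂p.act t h = b := by simp
  rw [← h1 (_ + _)]
  exact lintegral_mono_ae ((p.feasible t h).mono fun a ha => m.stateValue_add_le h.2 ha)

theorem costToAccess_thresholdPolicy_le (m : CacheModel) {s₀ : CacheState} {n : ℕ}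
    (h₀ : m.Bounded n s₀.1) (t : ℕ) :
    m.costToAccess m.thresholdPolicy.toPolicy s₀ (t + 1) ≤
      m.costToAccess m.thresholdPolicy.toPolicy s₀ t +
        m.renewalCost * m.accessProb m.thresholdPolicy.toPolicy s₀ t := by
  rw [costToAccess_add, m.costToAccess_succ _ h₀]
  refine lintegral_mono_ae ?_
  filter_upwards [m.ae_bounded _ h₀ t] with h hh
  refine add_le_add_right ?_ _
  change ∫⁻ a, (stageCost h.2 a + m.nextExp m.value h.2.1 a)
    ∂(Kernel.deterministic (fun h : CacheHist t => m.thresholdPolicy.act h.2)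
      (m.thresholdPolicy.measurable.comp measurable_snd) h) ≤ _
  rw [Kernel.deterministic_apply, lintegral_dirac' _ (measurable_of_countable _)]
  exact le_stateValue_add hh.1

/-- Both start from the same value, and the renewal terms agree since access probabilities are
independent of the policy. -/
theorem costToAccess_thresholdPolicy_le_costToAccess (m : CacheModel) (q : m.Policy)
    {s₀ : CacheState} {n : ℕ} (h₀ : m.Bounded n s₀.1) (t : ℕ) :
    m.costToAccess m.thresholdPolicy.toPolicy s₀ t ≤ m.costToAccess q s₀ t := by
  induction t with
  | zero => rw [costToAccess_zero, costToAccess_zero]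
  | succ t ih =>
    refine (m.costToAccess_thresholdPolicy_le h₀ t).trans
      (le_trans ?_ (m.costToAccess_add_le q h₀ t))
    rw [m.accessProb_eq _ q]
    gcongr

/-- Stated from slot `1` on, where the channel cost is a fresh sample; the initial cost is an
arbitrary real number. -/
theorem lintegral_stateValue_le (m : CacheModel) (p : m.Policy) {s₀ : CacheState} {n : ℕ}
    (h₀ : m.Bounded n s₀.1) (t : ℕ) : ∫⁻ h, m.stateValue h.2 ∂m.histLaw p s₀ (t + 1) ≤
      (n + m.Mmax * m.Dmax + m.Dmax * m.Mmax : ℕ) * m.meanCost := by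
  have h1 (b : ℝ≥0∞) : ∫⁻ _, b ∂m.histLaw p s₀ t = b := by simp
  have h0 : Measurable fun h : CacheHist (t + 1) => m.stateValue h.2 :=
    m.measurable_stateValue.comp measurable_snd
  rw [lintegral_histLaw_succ m p s₀ t h0, ← h1 (_ * _)]
  refine lintegral_mono_ae ?_
  filter_upwards [m.ae_bounded p h₀ t] with h hh
  have h2 (b : ℝ≥0∞) : ∫⁻ _, b ∂p.act t h = b := by simp
  rw [← h2 (_ * _)]
  refine lintegral_mono_ae ?_
  filter_upwards [p.feasible t h] with a ha
  change ∫⁻ s, m.stateValue s ∂m.stateKernel (h.2, a) ≤ _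
  rw [lintegral_stateKernel _ _ _ m.measurable_stateValue, m.nextExp_lintegral_stateValue hh.1 ha]
  calc m.nextExp m.value h.2.1 a
      ≤ m.nextExp (fun _ => (n + m.Mmax * m.Dmax + m.Dmax * m.Mmax : ℕ) * m.meanCost) h.2.1 a := by
        refine m.nextExp_mono fun N hN u hu => ?_
        obtain ⟨h3, h4⟩ := m.bounded_nextCtrl hh ha hN hu
        refine (value_le h3).trans ?_
        have h5 : (if (nextCtrl h.2.1 a N u).E = 0 then m.Dmax else (nextCtrl h.2.1 a N u).E) ≤
            m.Dmax := by
          have := h3.E_lt_Dmax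
          split_ifs <;> omega
        have h6 : (nextCtrl h.2.1 a N u).O.card ≤ n + m.Mmax * m.Dmax :=
          (Nat.le_add_right _ _).trans (h4.trans (by gcongr))
        gcongr
    _ = _ := by simp [nextExp, PMF.expect_const]

theorem expAvgCost_eq (m : CacheModel) (p : m.Policy) (s₀ : CacheState) (T : ℕ) :
    m.expAvgCost p s₀ T = (∫⁻ h, histCost h ∂m.histLaw p s₀ T) / T := by
  unfold expAvgCost
  simp_rw [div_eq_mul_inv]
  exact lintegral_mul_const _ (measurable_histCost T)

theorem isOptimal_thresholdPolicy (m : CacheModel) : m.IsOptimal m.thresholdPolicy.toPolicy := by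
  intro x hx c q
  have h₀ : m.Bounded (x.O.card + x.I.card) (x, c).1 := ⟨hx, Nat.le_add_right _ _⟩
  set K : ℝ≥0∞ := (x.O.card + x.I.card + m.Mmax * m.Dmax + m.Dmax * m.Mmax : ℕ) * m.meanCost
    with hK
  have hKtop : K ≠ ∞ :=
    ENNReal.mul_ne_top (ENNReal.natCast_ne_top _) (m.meanCost_lt.trans_le le_top).ne
  have hlim : Tendsto (fun T : ℕ => K / T) atTop (nhds 0) := by
    simp_rw [div_eq_mul_inv]
    simpa using ENNReal.Tendsto.const_mul ENNReal.tendsto_inv_nat_nhds_zero (Or.inr hKtop)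
  calc m.avgCost m.thresholdPolicy.toPolicy (x, c)
      ≤ limsup ((fun T : ℕ => m.expAvgCost q (x, c) T) + fun T : ℕ => K / T) atTop := by
        refine limsup_le_limsup ?_
        filter_upwards [eventually_ge_atTop 1] with T hT
        obtain ⟨t, rfl⟩ := Nat.exists_eq_add_of_le' hT
        rw [Pi.add_apply, expAvgCost_eq, expAvgCost_eq, ← ENNReal.add_div]
        refine ENNReal.div_le_div_right ?_ _
        calc ∫⁻ h, histCost h ∂m.histLaw m.thresholdPolicy.toPolicy (x, c) (t + 1)
            ≤ m.costToAccess m.thresholdPolicy.toPolicy (x, c) (t + 1) :=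
              lintegral_mono fun h => le_self_add
          _ ≤ m.costToAccess q (x, c) (t + 1) :=
              m.costToAccess_thresholdPolicy_le_costToAccess q h₀ _
          _ = _ := lintegral_add_left (measurable_histCost _) _
          _ ≤ _ := add_le_add_right (m.lintegral_stateValue_le q h₀ t) _
    _ = m.avgCost q (x, c) := ENNReal.limsup_add_of_right_tendsto_zero hlim _

end CacheModel

theorem theorem1 (m : CacheModel) :
    ∃ p : m.StationaryPolicy, m.IsOptimal p.toPolicy ∧
      ∀ x : CtrlState, m.IsState x → 0 < x.E →
        ∃ B' : ℕ, B' ≤ m.B ∧ ∃ T : ℕ → ℝ,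
          (∀ i j, i ≤ j → j < B' → T j ≤ T i) ∧ (∀ i < B', T i < m.Cmax) ∧
          ∀ c : ℝ, ∃ J : Finset ℕ, (∀ i, i ∈ J ↔ i < B' ∧ c ≤ T i) ∧
            p.act (x, c) = m.swaps x J := by
  refine ⟨m.thresholdPolicy, m.isOptimal_thresholdPolicy, fun x hx hE => ?_⟩
  obtain ⟨-, h1, h2⟩ := (m.exists_threshold_swaps x).choose_spec
  obtain ⟨-, T, h3, h4, h5⟩ := h2 hx hE.ne'
  -- `B'` is the number of simple actions at cost `0`, the largest over all costs.
  refine ⟨m.numSwaps x 0, (h1 0).trans (m.gain_le x), T, h3, h4, fun c =>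
    ⟨Finset.range (m.numSwaps x c), fun i => Finset.mem_range.trans (h5 c i), ?_⟩⟩
  change m.thresholdAct (x, c) = _
  simp only [CacheModel.thresholdAct, if_neg hE.ne', if_pos hx]
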